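/- Let $d=mJ$ with positive integers $d,m,J$ and $m>1$, and let $W\subset\mathbb{Z}_m=\{0,1,\dots,m-1\}$ have exactly $L$ elements, where $L<m$. Put $$\Omega=\bigcup_{r\in W}(m\mathbb{Z}_d+r)\subset\mathbb{Z}_d .$$ For $\mathbf a\in\ell^2(\mathbb{Z}_d)$ let $\hat{\mathbf a}(k)=\sum_{j\in\mathbb{Z}_d}\mathbf a(j)e^{-2\pi i jk/d}$, and for $k=0,\dots,J-1$ let $$\mathbf D_k=\mathrm{diag}\bigl(\hat{\mathbf a}(k),\hat{\mathbf a}(k+J),\dots,\hat{\mathbf a}(k+(m-1)J)\bigr)\in\mathbb{C}^{m\times m}.$$ For a diagonalizable matrix $\mathbf B$ let $M_{\mathbf B}$ be the largest geometric multiplicity among its eigenvalues. Let $\mathcal B_L$ be the set of matrices $\mathbf A\in\mathbb{C}^{d\times d}$ for which there is $\mathbf a\in\ell^2(\mathbb{Z}_d)$ with $\mathbf A\mathbf f=\mathbf a*\mathbf f$ (circular convolution) for all $\mathbf f\in\ell^2(\mathbb{Z}_d)$ and $\max_{0\le k\le J-1}M_{\mathbf D_k}=L$. For $\mathbf A\in\mathcal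 B_L$ let $$Y=\{\mathbf e_i,\mathbf A\mathbf e_i,\dots,\mathbf A^{m-1}\mathbf e_i : i\in\Omega\},$$ where $(\mathbf e_i)_{i\in\mathbb{Z}_d}$ is the canonical basis of $\ell^2(\mathbb{Z}_d)$. (A finite family $(\mathbf g_j)$ in $\ell^2(\mathbb{Z}_d)$ is a frame if there are constants $\alpha,\beta>0$ with $\alpha\|\mathbf f\|^2\le\sum_j|\langle\mathbf f,\mathbf g_j\rangle|^2\le\beta\|\mathbf f\|^2$ for all $\mathbf f$.) Then: 1. If $W=\{0,1,\dots,L-1\}$, then $Y$ is a frame for $\ell^2(\mathbb{Z}_d)$ for every $\mathbf A\in\mathcal B_L$. 2. If $m$ is prime, then $Y$ is a frame for $\ell^2(\mathbb{Z}_d)$ for every $\mathbf A\in\mathcal B_L$. 3. If $m$ is a power of a prime and $W$ is uniformly distributed over the divisors of $m$, that is, for every positive divisor $n$ of $m$ each of the $n$ cosets of the subgroup $\langle n\rangle$ of $\mathbb{Z}_m$ contains exactly $\lfloor |W|/n\rfloor$ or $\lceil |W|/n\rceil$ elements of $W$, then $Y$ is a frame for $\ell^2(\mathbb{Z}_d)$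 for every $\mathbf A\in\mathcal B_L$. -/

import Mathlib

/-- A finite family `y` in an inner product space is a frame: there are bounds `0 < α`, `0 < β` with
`α ‖f‖² ≤ ∑ᵢ |⟨f, yᵢ⟩|² ≤ β ‖f‖²` for all `f`. -/
def IsFiniteFrame {ι H : Type*} [Fintype ι] [NormedAddCommGroup H] [InnerProductSpace ℂ H]
    (y : ι → H) : Prop :=
  ∃ α β : ℝ, 0 < α ∧ 0 < β ∧ ∀ f : H,
    α * ‖f‖ ^ 2 ≤ ∑ i, ‖inner ℂ (y i) f‖ ^ 2 ∧ ∑ i, ‖inner ℂ (y i) f‖ ^ 2 ≤ β * ‖f‖ ^ 2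

/-- Circular convolution on `ℤ/dℤ`. -/
def circConv {d : ℕ} [NeZero d] (a f : ZMod d → ℂ) : ZMod d → ℂ :=
  fun i => ∑ j, a j * f (i - j)

/-- The largest geometric multiplicity among all eigenvalues of a square matrix. -/
noncomputable def maxGeomMult {n : Type*} [Fintype n] [DecidableEq n] (B : Matrix n n ℂ) : ℕ :=
  sSup {k : ℕ | ∃ μ : ℂ, Module.End.HasEigenvalue (Matrix.toLin' B) μ ∧
    k = Module.finrank ℂ (Module.End.eigenspace (Matrix.toLin' B) μ)}

/-- The set of which `maxGeomMult` is the supremum is bounded, so the supremum is not a junk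
value. -/
theorem bddAbove_geomMult {n : Type*} [Fintype n] [DecidableEq n] (B : Matrix n n ℂ) :
    BddAbove {k : ℕ | ∃ μ : ℂ, Module.End.HasEigenvalue (Matrix.toLin' B) μ ∧
      k = Module.finrank ℂ (Module.End.eigenspace (Matrix.toLin' B) μ)} := by
  refine ⟨Module.finrank ℂ (n → ℂ), ?_⟩
  rintro k ⟨μ, -, rfl⟩
  exact Submodule.finrank_le _

/-- The `k`-th slice of the unnormalized discrete Fourier transform of `a`:
the vector with entries `â(k + l J)`, `l = 0, …, m - 1`. -/
noncomputable def fourierSlice {d : ℕ} [NeZero d] (m J : ℕ) (a : ZMod d → ℂ) (k : ℕ) :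
    ZMod m → ℂ :=
  fun l => ZMod.dft a ((k + l.val * J : ℕ) : ZMod d)

/-- The class `𝓑_L`: the matrices `A` of operators of circular convolution with some kernel `a` on
`ℤ/dℤ` for which the largest geometric multiplicity of an eigenvalue of the diagonal matrices
`diag(a_k)`, `k = 0, …, J - 1`, is `L`. -/
def classB (d m J L : ℕ) [NeZero d] [NeZero m] : Set (Matrix (ZMod d) (ZMod d) ℂ) :=
  {A | ∃ a : ZMod d → ℂ, (∀ f : ZMod d → ℂ, A.mulVec f = circConv a f) ∧
    (Finset.range J).sup (fun k => maxGeomMult (Matrix.diagonal (fourierSlice m J a k))) = L}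

open Classical in
/-- The union of the periodic sets `m ℤ_d + r`, `r ∈ W ⊆ ℤ_m`, as a subset of `ℤ_d`. -/
noncomputable def periodicUnion (d m : ℕ) [NeZero d] (W : Finset (ZMod m)) : Finset (ZMod d) :=
  {i | ∃ r ∈ W, ∃ j ∈ AddSubgroup.zmultiples (m : ZMod d), i = j + (r.val : ZMod d)}

/-- The family `A ^ s e_i`, `i ∈ Ω`, `s = 0, …, m - 1`, in `ℓ²(ℤ_d)`. -/
noncomputable def iterates {d : ℕ} [NeZero d] (m : ℕ) (A : Matrix (ZMod d) (ZMod d) ℂ)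
    (Ω : Finset (ZMod d)) : Ω × Fin m → EuclideanSpace ℂ (ZMod d) :=
  fun p => WithLp.toLp 2 ((A ^ (p.2 : ℕ)).mulVec (Pi.single (p.1 : ZMod d) 1))

open Classical in
/-- `W ⊆ ℤ_m` is uniformly distributed over the divisors of `m`: for each divisor `n` of `m`,
each of the cosets of `⟨n⟩` in `ℤ_m` meets `W` in `⌊|W|/n⌋` or `⌈|W|/n⌉` elements. -/
def UniformlyDistributedOverDivisors (m : ℕ) (W : Finset (ZMod m)) : Prop :=
  ∀ n : ℕ, n ∣ m → ∀ c : ZMod m,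
    (W.filter fun w => w - c ∈ AddSubgroup.zmultiples (n : ZMod m)).card
        = ⌊(W.card : ℚ) / (n : ℚ)⌋₊ ∨
    (W.filter fun w => w - c ∈ AddSubgroup.zmultiples (n : ZMod m)).card
        = ⌈(W.card : ℚ) / (n : ℚ)⌉₊

/-!
The iterates form a frame as soon as the only vector orthogonal to all of them is zero
(`isFiniteFrame_of_forall_inner_eq_zero`). After a Fourier transform, convolution becomes
multiplication by `â`, and periodicity of `Ω` lets the frequencies in different residue classes
modulo `J` be separated by a Vandermonde argument (`sum_fourierSlice_pow_mul_eq_zero`). In each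
class, a second Vandermonde argument, over the powers `s < m`, separates the frequencies
`l` according to the value of `â(k + l J)`. What is left, for each eigenvalue of each `D_k`, is a
linear system whose matrix consists of the rows `W` of the `m × m` Fourier matrix and of at most
`L = |W|` of its columns. Hence the frame property follows once all maximal minors of the Fourier
matrix with rows `W` are nonzero (`HasFullSpark`).

For `W = {0, …, L - 1}` these minors are Vandermonde determinants. For a prime power `m = p ^ k`,
Newton interpolation writes such a minor, with columns `z_0, …, z_{L - 1}`, as the product of a
nonzero triangular determinant and the determinant of the divided differences of the monomials
`X ^ w`, `w ∈ W` (`det_pow_eq_det_dividedDifference_mul`). The latter is the value at a primitive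
`m`-th root of unity of an integer polynomial `g`, obtained by taking powers of the variable as
nodes. If it vanished, `g` would be divisible by the `m`-th cyclotomic polynomial, and `p` would
divide `g(1)`. At `1` all nodes coincide and the divided differences become binomial coefficients,
so that `g(1)` is the determinant of the `w.choose j`, which is the quotient of the Vandermonde
determinants of `W` and of `{0, …, L - 1}`. The `p`-adic valuation of a Vandermonde determinant
counts the pairs congruent modulo `p ^ e`, for all `e ≥ 1`, and for uniformly distributed sets this
count depends only on their size; so the quotient is prime to `p`
(`not_dvd_det_choose_of_balancedMod`). A prime `m` is the special case in which `W` is arbitrary.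
-/

/-! ### Newton interpolation and generalized Vandermonde determinants -/

open Polynomial in
/-- The successive quotients in Newton's interpolation scheme with nodes `z 0, z 1, …`: one starts
from `f` and divides by `X - z n` at the `n`-th step, discarding the remainder. -/
noncomputable def newtonQuotient {R : Type*} [CommRing R] (z : ℕ → R) (f : R[X]) : ℕ → R[X]
  | 0 => f
  | n + 1 => newtonQuotient z f n /ₘ (X - C (z n))

open Polynomial in
/-- The divided difference of `f` at the nodes `z 0, …, z n`, that is, the remainder discarded in
the `n`-th step of Newton's scheme. -/
noncomputable def dividedDifference {R : Type*} [CommRing R] (z : ℕ → R) (f : R[X]) (n : ℕ) : R :=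
  (newtonQuotient z f n).eval (z n)

section Newton

open Polynomial

variable {R S : Type*} [CommRing R] [CommRing S]

theorem newtonQuotient_eq (z : ℕ → R) (f : R[X]) (n : ℕ) :
    newtonQuotient z f n
      = C (dividedDifference z f n) + (X - C (z n)) * newtonQuotient z f (n + 1) := by
  have h := modByMonic_add_div (newtonQuotient z f n) (X - C (z n))
  rw [modByMonic_X_sub_C_eq_C_eval] at h
  exact h.symm

/-- Newton's interpolation formula with remainder. -/
theorem eval_eq_sum_dividedDifference_add (z : ℕ → R) (f : R[X]) (t : R) (N : ℕ) :
    f.eval t = ∑ n ∈ Finset.range N, dividedDifference z f n * ∏ l ∈ Finset.range n, (t - z l)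
      + (newtonQuotient z f N).eval t * ∏ l ∈ Finset.range N, (t - z l) := by
  induction N with
  | zero => simp [newtonQuotient]
  | succ N ih =>
    rw [ih, newtonQuotient_eq z f N, Finset.sum_range_succ, Finset.prod_range_succ]
    simp only [eval_add, eval_mul, eval_sub, eval_X, eval_C]
    ring

theorem eval_node_eq_sum_dividedDifference (z : ℕ → R) (f : R[X]) {j N : ℕ} (hj : j < N) :
    f.eval (z j)
      = ∑ n ∈ Finset.range N, dividedDifference z f n * ∏ l ∈ Finset.range n, (z j - z l) := by
  rw [eval_eq_sum_dividedDifference_add z f (z j) N,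
    Finset.prod_eq_zero (Finset.mem_range.2 hj) (sub_self _), mul_zero, add_zero]

theorem newtonQuotient_map (φ : R →+* S) (z : ℕ → R) (f : R[X]) (n : ℕ) :
    newtonQuotient (fun i => φ (z i)) (f.map φ) n = (newtonQuotient z f n).map φ := by
  induction n with
  | zero => rfl
  | succ n ih =>
    simp only [newtonQuotient]
    rw [ih, map_divByMonic φ (monic_X_sub_C _)]
    simp

theorem dividedDifference_map (φ : R →+* S) (z : ℕ → R) (f : R[X]) (n : ℕ) :
    dividedDifference (fun i => φ (z i)) (f.map φ) n = φ (dividedDifference z f n) := by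
  rw [dividedDifference, newtonQuotient_map, eval_map_apply, dividedDifference]

theorem taylor_newtonQuotient_const_coeff (a : R) (f : R[X]) (n j : ℕ) :
    (taylor a (newtonQuotient (fun _ => a) f n)).coeff j = (taylor a f).coeff (n + j) := by
  induction n generalizing j with
  | zero => simp [newtonQuotient]
  | succ n ih =>
    have h := congrArg (fun q => (taylor a q).coeff (j + 1)) (newtonQuotient_eq (fun _ => a) f n)
    simp only [ih, map_add, taylor_mul, taylor_C, map_sub, taylor_X, add_sub_cancel_right,
      coeff_add, coeff_X_mul, coeff_C_succ, zero_add] at h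
    rw [← h]
    congr 1
    ring

/-- When all nodes coincide, the divided differences are the Taylor coefficients. -/
theorem dividedDifference_const (a : R) (f : R[X]) (n : ℕ) :
    dividedDifference (fun _ => a) f n = (taylor a f).coeff n := by
  rw [dividedDifference, ← add_zero n, ← taylor_newtonQuotient_const_coeff, taylor_coeff_zero]
  simp

theorem dividedDifference_one_X_pow (w n : ℕ) :
    dividedDifference (fun _ => (1 : R)) (X ^ w) n = (w.choose n : R) := by
  rw [dividedDifference_const, taylor_pow, taylor_X, C_1, coeff_X_add_one_pow]

/-- Newton interpolation factors a generalized Vandermonde determinant into the determinant of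
divided differences and the determinant of a triangular matrix. -/
theorem det_pow_eq_det_dividedDifference_mul (L : ℕ) (z : ℕ → R) (w : Fin L → ℕ) :
    (Matrix.of fun i j : Fin L => z j ^ w i).det
      = (Matrix.of fun i n : Fin L => dividedDifference z (X ^ w i) n).det
        * ∏ j : Fin L, ∏ l ∈ Finset.range j, (z j - z l) := by
  have hT : (Matrix.of fun n j : Fin L => ∏ l ∈ Finset.range n, (z j - z l)).det
      = ∏ j : Fin L, ∏ l ∈ Finset.range j, (z j - z l) := by
    rw [Matrix.det_of_isUpperTriangular]
    · rfl
    · intro n j hjn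
      exact Finset.prod_eq_zero (Finset.mem_range.2 (show (j : ℕ) < n from hjn)) (sub_self _)
  rw [← hT, ← Matrix.det_mul]
  congr 1
  ext i j
  simp only [Matrix.of_apply, Matrix.mul_apply]
  have := eval_node_eq_sum_dividedDifference z (X ^ w i) j.isLt
  rw [eval_pow, eval_X] at this
  rw [this, Finset.sum_range]

end Newton

/-! ### Valuations of Vandermonde determinants of balanced families -/

section Balanced

open Finset

/-- A family of `L` natural numbers is balanced modulo `n` if each residue class modulo `n` contains
`⌊L / n⌋` or `⌊L / n⌋ + 1` of its members. -/
def BalancedMod {L : ℕ} (n : ℕ) (v : Fin L → ℕ) : Prop :=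
  ∀ c, #{i | v i ≡ c [MOD n]} = L / n ∨ #{i | v i ≡ c [MOD n]} = L / n + 1

theorem balancedMod_val (L : ℕ) {n : ℕ} (hn : 0 < n) :
    BalancedMod n (fun i : Fin L => (i : ℕ)) := by
  intro c
  have h : #{i : Fin L | (i : ℕ) ≡ c [MOD n]} = L.count (· ≡ c [MOD n]) := by
    rw [Nat.count_eq_card_filter_range, card_filter, card_filter,
      Fin.sum_univ_eq_sum_range (fun i => if i ≡ c [MOD n] then 1 else 0) L]
  rw [h, Nat.count_modEq_card _ hn]
  split_ifs <;> simp

/-- The number of pairs congruent modulo `n` in a balanced family depends only on the size of the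
family: a class with `N ∈ {q, q + 1}` members contributes `N ^ 2 = (2 * q + 1) * N - q * (q + 1)`
pairs, which is affine in `N`. -/
theorem BalancedMod.sum_card_eq {L n : ℕ} (hn : 0 < n) {v : Fin L → ℕ} (hv : BalancedMod n v) :
    (∑ i, #{j | v j ≡ v i [MOD n]}) + n * (L / n * (L / n + 1)) = (2 * (L / n) + 1) * L := by
  set q := L / n
  have hmaps : ∀ i ∈ (univ : Finset (Fin L)), v i % n ∈ range n :=
    fun i _ => mem_range.2 (Nat.mod_lt _ hn)
  have hcard : ∀ c ∈ range n, #{i | v i % n = c} = #{i | v i ≡ c [MOD n]} := by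
    intro c hc
    simp [Nat.ModEq, Nat.mod_eq_of_lt (mem_range.1 hc)]
  have hL : L = ∑ c ∈ range n, #{i | v i ≡ c [MOD n]} := by
    rw [← sum_congr rfl hcard, ← card_eq_sum_card_fiberwise hmaps, card_univ, Fintype.card_fin]
  have hQ : ∑ i, #{j | v j ≡ v i [MOD n]} = ∑ c ∈ range n, #{i | v i ≡ c [MOD n]} ^ 2 := by
    rw [← sum_fiberwise_of_maps_to hmaps]
    refine sum_congr rfl fun c hc => ?_
    rw [sum_congr rfl (g := fun _ => #{i | v i ≡ c [MOD n]}), sum_const, hcard c hc, smul_eq_mul,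
      sq]
    intro i hi
    have hi' : v i ≡ c [MOD n] := by
      rw [Nat.ModEq, (mem_filter.1 hi).2, Nat.mod_eq_of_lt (mem_range.1 hc)]
    congr 1
    ext j
    simp only [mem_filter, mem_univ, true_and]
    exact ⟨fun h => h.trans hi', fun h => h.trans hi'.symm⟩
  have hn' : n * (q * (q + 1)) = ∑ c ∈ range n, q * (q + 1) := by simp
  conv_rhs => rw [hL]
  rw [hQ, hn', ← sum_add_distrib, mul_sum]
  refine sum_congr rfl fun c _ => ?_
  rcases hv c with h | h <;> rw [h] <;> ring

/-- The `p`-adic valuation of a Vandermonde determinant counts congruent pairs. Ordered pairs are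
counted on the right, whence the factor `2`; they include the diagonal, whence the term
`(b - 1) * L`. -/
theorem two_mul_factorization_det_vandermonde {p b L : ℕ} (hp : p.Prime) {v : Fin L → ℕ}
    (hv : Function.Injective v) (hlt : ∀ i, v i < p ^ b) :
    2 * (Matrix.vandermonde fun i => (v i : ℤ)).det.natAbs.factorization p + (b - 1) * L
      = ∑ e ∈ Ico 1 b, ∑ i, #{j | v j ≡ v i [MOD p ^ e]} := by
  have hne : ∀ i j, i ≠ j → ((v j : ℤ) - v i).natAbs ≠ 0 := by
    intro i j hij h
    rw [Int.natAbs_eq_zero, sub_eq_zero, Nat.cast_inj] at h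
    exact hij (hv h).symm
  have hfac : ∀ i j, i ≠ j → ((v j : ℤ) - v i).natAbs.factorization p
      = ∑ e ∈ Ico 1 b, if v j ≡ v i [MOD p ^ e] then 1 else 0 := by
    intro i j hij
    have hb : ((v j : ℤ) - v i).natAbs < p ^ b := by
      have := hlt i
      have := hlt j
      omega
    rw [Nat.factorization_eq_card_pow_dvd_of_lt hp (Nat.pos_of_ne_zero (hne i j hij)) hb,
      card_filter]
    refine sum_congr rfl fun e _ => ?_
    congr 1
    rw [← Int.natCast_dvd, eq_iff_iff, Nat.ModEq.comm, Nat.modEq_iff_dvd]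
  have hdet : (Matrix.vandermonde fun i => (v i : ℤ)).det.natAbs.factorization p
      = ∑ i, ∑ j ∈ Ioi i, ((v j : ℤ) - v i).natAbs.factorization p := by
    rw [Matrix.det_vandermonde, ← Int.natAbsHom_apply, map_prod, Nat.factorization_prod,
      Finsupp.finsetSum_apply]
    · refine sum_congr rfl fun i _ => ?_
      rw [map_prod, Nat.factorization_prod, Finsupp.finsetSum_apply]
      · rfl
      · exact fun j hj => hne i j (mem_Ioi.1 hj).ne
    · intro i _
      rw [map_prod]
      exact prod_ne_zero_iff.2 fun j hj => hne i j (mem_Ioi.1 hj).ne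
  have hsymm := sum_sum_Ioi_add_eq_sum_sum_off_diag
    (fun i j : Fin L => ((v i : ℤ) - v j).natAbs.factorization p)
  have h2 : 2 * (Matrix.vandermonde fun i => (v i : ℤ)).det.natAbs.factorization p
      = ∑ i, ∑ j ∈ {i}ᶜ, ((v j : ℤ) - v i).natAbs.factorization p := by
    rw [hdet, ← hsymm, mul_sum]
    refine sum_congr rfl fun i _ => ?_
    rw [mul_sum]
    refine sum_congr rfl fun j _ => ?_
    rw [two_mul, ← Int.natAbs_neg ((v i : ℤ) - v j), neg_sub]
  have hrow : ∀ i, ∑ j ∈ {i}ᶜ, ((v j : ℤ) - v i).natAbs.factorization p + (b - 1)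
      = ∑ e ∈ Ico 1 b, #{j | v j ≡ v i [MOD p ^ e]} := by
    intro i
    rw [sum_congr rfl fun j hj => hfac i j (by simpa [eq_comm] using hj)]
    have hd : b - 1 = ∑ e ∈ Ico 1 b, if v i ≡ v i [MOD p ^ e] then 1 else 0 := by
      simp [Nat.ModEq.refl]
    conv_lhs => rw [hd]
    rw [← sum_singleton (fun j => ∑ e ∈ Ico 1 b, if v j ≡ v i [MOD p ^ e] then 1 else 0) i,
      sum_compl_add_sum, sum_comm]
    simp only [card_filter]
  rw [h2, sum_comm, ← sum_congr rfl fun i _ => hrow i, sum_add_distrib]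
  simp [mul_comm]

end Balanced

/-! ### Minors of the character table of a cyclic group of prime power order -/

section Spark

open Finset Polynomial

theorem det_vandermonde_eq_prod_factorial_mul_det_choose {L : ℕ} (v : Fin L → ℕ) :
    (Matrix.vandermonde fun i => (v i : ℤ)).det
      = (∏ i : Fin L, ((i : ℕ).factorial : ℤ))
        * (Matrix.of fun i j : Fin L => ((v i).choose j : ℤ)).det := by
  rw [Matrix.det_eval_matrixOfPolynomials_eq_det_vandermonde (fun i => (v i : ℤ))
    (fun i => descPochhammer ℤ i) (fun i => descPochhammer_natDegree ℤ i)
    (fun i => monic_descPochhammer ℤ i), ← Matrix.det_mul_row]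
  congr 1
  ext i j
  rw [Matrix.of_apply, Matrix.of_apply, Matrix.of_apply, descPochhammer_eval_eq_descFactorial,
    Nat.descFactorial_eq_factorial_mul_choose]
  push_cast
  rfl

theorem det_vandermonde_val_eq_prod_factorial (L : ℕ) :
    (Matrix.vandermonde fun i : Fin L => ((i : ℕ) : ℤ)).det
      = ∏ i : Fin L, ((i : ℕ).factorial : ℤ) := by
  rw [det_vandermonde_eq_prod_factorial_mul_det_choose fun i : Fin L => (i : ℕ),
    Matrix.det_of_isLowerTriangular]
  · simp
  · intro i j hij
    have : (i : ℕ) < j := hij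
    simp [Nat.choose_eq_zero_of_lt this]

/-- If `v` is balanced modulo all powers of `p` that matter, then its Vandermonde determinant has
the same `p`-adic valuation as that of `0, …, L - 1`; the quotient of the two is the determinant of
binomial coefficients. -/
theorem not_dvd_det_choose_of_balancedMod {p b L : ℕ} (hp : p.Prime) {v : Fin L → ℕ}
    (hv : Function.Injective v) (hlt : ∀ i, v i < p ^ b) (hL : L ≤ p ^ b)
    (hbal : ∀ e ∈ Ico 1 b, BalancedMod (p ^ e) v) :
    ¬ (p : ℤ) ∣ (Matrix.of fun i j : Fin L => ((v i).choose j : ℤ)).det := by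
  -- Both Vandermonde determinants have the same valuation, since the counts agree by `h3`.
  have h1 := two_mul_factorization_det_vandermonde hp hv hlt
  have h2 := two_mul_factorization_det_vandermonde (b := b) hp
    (v := fun i : Fin L => (i : ℕ)) Fin.val_injective fun i => i.isLt.trans_le hL
  have h3 : ∑ e ∈ Ico 1 b, ∑ i, #{j | v j ≡ v i [MOD p ^ e]}
      = ∑ e ∈ Ico 1 b, ∑ i : Fin L, #{j : Fin L | (j : ℕ) ≡ i [MOD p ^ e]} := by
    refine sum_congr rfl fun e he => ?_
    have h4 := (hbal e he).sum_card_eq (pow_pos hp.pos e)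
    have h5 := (balancedMod_val L (pow_pos hp.pos e)).sum_card_eq (pow_pos hp.pos e)
    omega
  have hV : (Matrix.vandermonde fun i => (v i : ℤ)).det ≠ 0 :=
    Matrix.det_vandermonde_ne_zero_iff.2 fun i j h => hv (Nat.cast_injective h)
  have hmul := det_vandermonde_eq_prod_factorial_mul_det_choose v
  rw [← det_vandermonde_val_eq_prod_factorial] at hmul
  rw [hmul] at hV
  rw [hmul, Int.natAbs_mul, Nat.factorization_mul (Int.natAbs_ne_zero.2 (left_ne_zero_of_mul hV))
    (Int.natAbs_ne_zero.2 (right_ne_zero_of_mul hV)), Finsupp.add_apply] at h1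
  rw [Int.natCast_dvd]
  intro hdvd
  have := hp.factorization_pos_of_dvd (Int.natAbs_ne_zero.2 (right_ne_zero_of_mul hV)) hdvd
  omega

/-- An integer polynomial vanishing at a primitive root of unity of prime power order `p ^ (k + 1)`
takes a value divisible by `p` at `1`, being a multiple of the cyclotomic polynomial. -/
theorem dvd_eval_one_of_aeval_primitiveRoot_eq_zero {p k : ℕ} (hp : p.Prime) {K : Type*} [Field K]
    [CharZero K] {ζ : K} (hζ : IsPrimitiveRoot ζ (p ^ (k + 1))) {g : ℤ[X]} (hg : aeval ζ g = 0) :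
    (p : ℤ) ∣ g.eval 1 := by
  have := Fact.mk hp
  have hpos : 0 < p ^ (k + 1) := pow_pos hp.pos _
  have h := minpoly.isIntegrallyClosed_dvd (hζ.isIntegral hpos) hg
  rw [← cyclotomic_eq_minpoly hζ hpos] at h
  simpa using eval_dvd (x := (1 : ℤ)) h

theorem map_det_dividedDifference_X_pow {T : Type*} [CommRing T] {L : ℕ} (φ : ℤ[X] →+* T)
    (t : ℕ → ℕ) (v : Fin L → ℕ) :
    φ (Matrix.of fun i n : Fin L =>
        dividedDifference (fun l => (X : ℤ[X]) ^ t l) (X ^ v i) n).det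
      = (Matrix.of fun i n : Fin L =>
        dividedDifference (fun l => φ X ^ t l) (X ^ v i) n).det := by
  rw [RingHom.map_det]
  congr 1
  ext i n
  have := dividedDifference_map φ (fun l => (X : ℤ[X]) ^ t l) (X ^ v i) n
  simp only [Polynomial.map_pow, map_X, map_pow] at this
  simp [this]

/-- The minor of the character table of a cyclic group of prime power order with rows `v` is
nonzero whenever `v` is balanced modulo the powers of the prime. -/
theorem det_primitiveRoot_pow_ne_zero {p k L : ℕ} (hp : p.Prime) {K : Type*} [Field K] [CharZero K]
    {ζ : K} (hζ : IsPrimitiveRoot ζ (p ^ (k + 1))) {v : Fin L → ℕ} (hv : Function.Injective v)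
    (hlt : ∀ i, v i < p ^ (k + 1)) (hbal : ∀ e ∈ Ico 1 (k + 1), BalancedMod (p ^ e) v)
    {s : Fin L → ℕ} (hs : Function.Injective fun j => ζ ^ s j) :
    (Matrix.of fun i j : Fin L => (ζ ^ s j) ^ v i).det ≠ 0 := by
  have hL : L ≤ p ^ (k + 1) := by
    simpa using card_le_card_of_injOn (s := univ) (t := range (p ^ (k + 1))) v
      (fun i _ => by simpa using hlt i) hv.injOn
  -- `t` extends `s` to a sequence; the nodes `ζ ^ t n` are lifted to the powers `X ^ t n` in `ℤ[X]`.
  let t : ℕ → ℕ := fun n => if h : n < L then s ⟨n, h⟩ else 0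
  have ht : ∀ j : Fin L, t j = s j := fun j => by simp [t]
  let H : Matrix (Fin L) (Fin L) ℤ[X] :=
    Matrix.of fun i n => dividedDifference (fun l => X ^ t l) (X ^ v i) n
  have hone : H.det.eval 1 = (Matrix.of fun i j : Fin L => ((v i).choose j : ℤ)).det := by
    have := map_det_dividedDifference_X_pow (evalRingHom (1 : ℤ)) t v
    simpa [dividedDifference_one_X_pow] using this
  have hzeta : H.det.aeval ζ ≠ 0 := fun h0 =>
    not_dvd_det_choose_of_balancedMod hp hv hlt hL hbal
      (hone ▸ dvd_eval_one_of_aeval_primitiveRoot_eq_zero hp hζ h0)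
  have hfac := det_pow_eq_det_dividedDifference_mul L (fun n => ζ ^ t n) v
  have hH := map_det_dividedDifference_X_pow (aeval ζ : ℤ[X] →ₐ[ℤ] K).toRingHom t v
  simp only [AlgHom.toRingHom_eq_coe, RingHom.coe_coe, aeval_X] at hH
  simp only [ht] at hfac
  rw [hfac, ← hH]
  refine mul_ne_zero hzeta (prod_ne_zero_iff.2 fun j _ => prod_ne_zero_iff.2 fun l hl => ?_)
  have hlj : l < j := mem_range.1 hl
  have hl' := ht ⟨l, hlj.trans j.isLt⟩
  simp only at hl'
  rw [hl', sub_ne_zero]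
  intro h
  exact hlj.ne' (congrArg Fin.val (hs h))

end Spark

/-! ### Rows of the Fourier matrix with full spark -/

section Rows

open Finset

variable {m : ℕ} [NeZero m]

/-- The rows indexed by `W` of the Fourier matrix of `ℤ/mℤ` have full spark: any `|W|` or fewer
columns of the submatrix they form are linearly independent. -/
def HasFullSpark (W : Finset (ZMod m)) : Prop :=
  ∀ S : Finset (ZMod m), #S ≤ #W → ∀ c : ZMod m → ℂ,
    (∀ r ∈ W, ∑ l ∈ S, ZMod.stdAddChar (-(l * r)) * c l = 0) → ∀ l ∈ S, c l = 0

theorem stdAddChar_neg_mul (l r : ZMod m) :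
    (ZMod.stdAddChar (-(l * r)) : ℂ) = (ZMod.stdAddChar (-1 : ZMod m) ^ l.val) ^ r.val := by
  rw [← pow_mul, ← AddChar.map_nsmul_eq_pow, nsmul_eq_mul]
  congr 1
  simp

theorem injective_stdAddChar_neg_one_pow_val :
    Function.Injective fun l : ZMod m => (ZMod.stdAddChar (-1 : ZMod m) : ℂ) ^ l.val := by
  intro l l' h
  simp only [← AddChar.map_nsmul_eq_pow] at h
  simpa using ZMod.injective_stdAddChar h

theorem isPrimitiveRoot_stdAddChar_neg_one :
    IsPrimitiveRoot (ZMod.stdAddChar (-1 : ZMod m) : ℂ) m := by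
  refine IsPrimitiveRoot.iff_def _ _ |>.2 ⟨?_, fun n hn => ?_⟩
  · rw [← AddChar.map_nsmul_eq_pow]
    simp
  · rw [← AddChar.map_nsmul_eq_pow, ← AddChar.map_zero_eq_one (ZMod.stdAddChar (N := m))] at hn
    simpa [ZMod.natCast_eq_zero_iff] using ZMod.injective_stdAddChar hn

/-- It suffices that all maximal minors with rows `W` are nonzero. -/
theorem hasFullSpark_of_det_ne_zero {W : Finset (ZMod m)} {L : ℕ} (hW : #W = L)
    (w : Fin L → ZMod m) (hw : ∀ i, w i ∈ W)
    (hdet : ∀ s : Fin L → ZMod m, Function.Injective s →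
      (Matrix.of fun i j : Fin L =>
        ((ZMod.stdAddChar (-1 : ZMod m) : ℂ) ^ (s j).val) ^ (w i).val).det ≠ 0) :
    HasFullSpark W := by
  classical
  intro S hS c hc l hl
  obtain ⟨T, hST, hT⟩ := exists_superset_card_eq (s := S) (n := L) (hW ▸ hS)
    (hW ▸ card_le_univ W)
  let s : Fin L → ZMod m := fun j => ((T.equivFinOfCardEq hT).symm j : ZMod m)
  have hs : Function.Injective s :=
    Subtype.val_injective.comp (T.equivFinOfCardEq hT).symm.injective
  -- The coefficients are extended by zero from `S` to a set with exactly `L` elements.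
  let c' : ZMod m → ℂ := fun x => if x ∈ S then c x else 0
  have h0 : (fun j => c' (s j)) = 0 := by
    refine Matrix.eq_zero_of_mulVec_eq_zero (hdet s hs) (funext fun i => ?_)
    have h := hc (w i) (hw i)
    rw [← inter_eq_right.2 hST, ← sum_ite_mem] at h
    rw [Pi.zero_apply, ← h, ← T.sum_coe_sort, ← (T.equivFinOfCardEq hT).symm.sum_comp]
    simp only [Matrix.mulVec, dotProduct, Matrix.of_apply]
    refine sum_congr rfl fun j _ => ?_
    rw [← stdAddChar_neg_mul]
    simp [c', s]
  have h1 := congrFun h0 (T.equivFinOfCardEq hT ⟨l, hST hl⟩)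
  simpa [c', s, hl] using h1

theorem hasFullSpark_image_range {L : ℕ} (hL : L < m) :
    HasFullSpark ((range L).image (fun n : ℕ => (n : ZMod m))) := by
  have hval : ∀ n < L, (n : ZMod m).val = n := fun n hn => ZMod.val_cast_of_lt (hn.trans hL)
  refine hasFullSpark_of_det_ne_zero (L := L) ?_ (fun i => ((i : ℕ) : ZMod m)) ?_ ?_
  · rw [card_image_of_injOn, card_range]
    intro a ha b hb hab
    rw [← hval a (by simpa using ha), ← hval b (by simpa using hb)]
    exact congrArg ZMod.val hab
  · exact fun i => mem_image_of_mem _ (mem_range.2 i.isLt)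
  · intro s hs
    rw [← Matrix.det_transpose]
    convert Matrix.det_vandermonde_ne_zero_iff.2
      (injective_stdAddChar_neg_one_pow_val.comp hs) using 2
    ext i j
    simp [Matrix.vandermonde_apply, Nat.mod_eq_of_lt (j.isLt.trans hL)]

theorem hasFullSpark_of_balancedMod {p k : ℕ} (hp : p.Prime) (hm : m = p ^ (k + 1))
    {W : Finset (ZMod m)}
    (hbal : ∀ e ∈ Ico 1 (k + 1), ∀ c : ℕ, #{w ∈ W | w.val ≡ c [MOD p ^ e]} = #W / p ^ e ∨
      #{w ∈ W | w.val ≡ c [MOD p ^ e]} = #W / p ^ e + 1) :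
    HasFullSpark W := by
  refine hasFullSpark_of_det_ne_zero rfl (fun i => (W.equivFin.symm i : ZMod m))
    (fun i => (W.equivFin.symm i).2) fun s hs => ?_
  refine det_primitiveRoot_pow_ne_zero (v := fun i => (W.equivFin.symm i : ZMod m).val)
    (s := fun j => (s j).val) (ζ := ZMod.stdAddChar (-1 : ZMod m)) (k := k) hp ?_
    ((ZMod.val_injective m).comp (Subtype.val_injective.comp W.equivFin.symm.injective))
    (fun i => (ZMod.val_lt _).trans_eq hm) (fun e he c => ?_)
    (injective_stdAddChar_neg_one_pow_val.comp hs)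
  · rw [← hm]
    exact isPrimitiveRoot_stdAddChar_neg_one
  have : #{i | (W.equivFin.symm i : ZMod m).val ≡ c [MOD p ^ e]}
      = #{w ∈ W | w.val ≡ c [MOD p ^ e]} := by
    rw [card_filter, card_filter, ← W.sum_coe_sort, ← W.equivFin.symm.sum_comp]
  rw [this]
  exact hbal e he c

theorem sub_mem_zmultiples_iff_val_modEq {n : ℕ} (hn : n ∣ m) (w c : ZMod m) :
    w - c ∈ AddSubgroup.zmultiples (n : ZMod m) ↔ w.val ≡ c.val [MOD n] := by
  constructor
  · rintro ⟨z, hz⟩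
    have h := congrArg (ZMod.castHom hn (ZMod n)) hz
    simp only [zsmul_eq_mul, map_mul, map_natCast, CharP.cast_eq_zero, mul_zero, map_sub] at h
    rw [← ZMod.natCast_eq_natCast_iff, ← sub_eq_zero, h]
    conv_rhs => rw [← ZMod.natCast_zmod_val w, ← ZMod.natCast_zmod_val c, map_natCast, map_natCast]
  · intro h
    obtain ⟨z, hz⟩ := (Nat.modEq_iff_dvd.1 h.symm)
    refine ⟨z, ?_⟩
    have := congrArg (Int.cast : ℤ → ZMod m) hz
    push_cast at this
    rw [ZMod.natCast_zmod_val, ZMod.natCast_zmod_val] at this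
    simp [this, mul_comm]

theorem hasFullSpark_of_uniformlyDistributed (hm : IsPrimePow m) {W : Finset (ZMod m)}
    (hW : UniformlyDistributedOverDivisors m W) : HasFullSpark W := by
  obtain ⟨p, k, hp, hk, hpk⟩ := hm
  obtain ⟨k, rfl⟩ := Nat.exists_eq_add_of_le' hk
  refine hasFullSpark_of_balancedMod (Nat.prime_iff.2 hp) hpk.symm fun e he c => ?_
  have hdvd : p ^ e ∣ m := hpk ▸ pow_dvd_pow p (mem_Ico.1 he).2.le
  have hpe : 0 < p ^ e := Nat.pos_of_dvd_of_pos hdvd (NeZero.pos m)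
  have hceil : ⌈(#W : ℚ) / (p ^ e : ℕ)⌉₊ = #W / p ^ e
      ∨ ⌈(#W : ℚ) / (p ^ e : ℕ)⌉₊ = #W / p ^ e + 1 := by
    have h1 := Nat.floor_le_ceil ((#W : ℚ) / (p ^ e : ℕ))
    have h2 := Nat.ceil_le_floor_add_one ((#W : ℚ) / (p ^ e : ℕ))
    rw [Nat.floor_div_eq_div] at h1 h2
    omega
  have hc : ∀ w : ZMod m, w - (c : ZMod m) ∈ AddSubgroup.zmultiples ((p ^ e : ℕ) : ZMod m)
      ↔ w.val ≡ c [MOD p ^ e] := by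
    intro w
    rw [sub_mem_zmultiples_iff_val_modEq hdvd, ZMod.val_natCast]
    exact ⟨fun h => h.trans ((Nat.mod_modEq c m).of_dvd hdvd),
      fun h => h.trans ((Nat.mod_modEq c m).of_dvd hdvd).symm⟩
  have h := hW (p ^ e) hdvd c
  rw [Nat.floor_div_eq_div, filter_congr_decidable, filter_congr fun w _ => hc w] at h
  rcases h with h | h
  · exact Or.inl h
  · rw [h]
    exact hceil

/-- For prime `m` no modulus lies strictly between `1` and `m`, so every set of rows is balanced. -/
theorem hasFullSpark_of_prime (hm : m.Prime) (W : Finset (ZMod m)) : HasFullSpark W := by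
  refine hasFullSpark_of_balancedMod (k := 0) hm (by simp) fun e he => ?_
  simp at he

end Rows

/-! ### Frames, eigenvalue multiplicities and the discrete Fourier transform -/

section Analysis

open Finset ZMod

/-- In finite dimension a family with injective analysis operator is a frame: the operator is bounded
below. -/
theorem isFiniteFrame_of_forall_inner_eq_zero {ι H : Type*} [Fintype ι] [NormedAddCommGroup H]
    [InnerProductSpace ℂ H] [FiniteDimensional ℂ H] {y : ι → H}
    (hy : ∀ f : H, (∀ i, inner ℂ (y i) f = 0) → f = 0) : IsFiniteFrame y := by
  let T : H →ₗ[ℂ] EuclideanSpace ℂ ι :=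
    (WithLp.linearEquiv 2 ℂ (ι → ℂ)).symm.toLinearMap ∘ₗ
      LinearMap.pi fun i => (innerSL ℂ (y i)).toLinearMap
  have hT : ∀ f, ‖T f‖ ^ 2 = ∑ i, ‖inner ℂ (y i) f‖ ^ 2 := fun f => by
    rw [EuclideanSpace.norm_sq_eq]
    rfl
  have hker : LinearMap.ker T = ⊥ := by
    refine (Submodule.eq_bot_iff _).2 fun f hf => hy f fun i => ?_
    exact congrArg (fun x : EuclideanSpace ℂ ι => x i) (LinearMap.mem_ker.1 hf)
  obtain ⟨K, hK, hanti⟩ := T.exists_antilipschitzWith hker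
  have hK' : (0 : ℝ) < K := hK
  -- The summand `1` keeps the upper bound positive when the family vanishes or is empty.
  refine ⟨((K : ℝ) ^ 2)⁻¹, 1 + ∑ i, ‖y i‖ ^ 2, by positivity, by positivity, fun f => ⟨?_, ?_⟩⟩
  · have h := hanti.le_mul_norm (map_zero T) f
    rw [← hT, inv_mul_le_iff₀ (by positivity), ← mul_pow]
    exact pow_le_pow_left₀ (norm_nonneg f) h 2
  · rw [add_mul, sum_mul]
    refine le_add_of_nonneg_of_le (by positivity) (sum_le_sum fun i _ => ?_)
    rw [← mul_pow]
    exact pow_le_pow_left₀ (norm_nonneg _) (norm_inner_le_norm _ _) 2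

theorem card_filter_le_maxGeomMult_diagonal {n : Type*} [Fintype n] [DecidableEq n] (v : n → ℂ)
    (μ : ℂ) : #{l | v l = μ} ≤ maxGeomMult (Matrix.diagonal v) := by
  rcases (({l | v l = μ} : Finset n)).eq_empty_or_nonempty with h | ⟨l₀, hl₀⟩
  · simp [h]
  let E := Module.End.eigenspace (Matrix.toLin' (Matrix.diagonal v)) μ
  have hmem : ∀ l : ({l | v l = μ} : Finset n), (Pi.single (l : n) (1 : ℂ) : n → ℂ) ∈ E := by
    rintro ⟨l, hl⟩
    rw [Module.End.mem_eigenspace_iff, Matrix.toLin'_apply, Matrix.diagonal_mulVec_single,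
      (mem_filter.1 hl).2]
    simp [← Pi.single_smul']
  have hli : LinearIndependent ℂ
      fun l : ({l | v l = μ} : Finset n) => (⟨_, hmem l⟩ : E) := by
    refine LinearIndependent.of_comp E.subtype ?_
    exact (Pi.linearIndependent_single_one n ℂ).comp _ Subtype.val_injective
  have hle : #{l | v l = μ} ≤ Module.finrank ℂ E := by
    simpa only [Fintype.card_coe] using hli.fintype_card_le_finrank
  refine hle.trans (le_csSup (bddAbove_geomMult _) ⟨μ, ?_, rfl⟩)
  intro hbot
  have h0 := hmem ⟨l₀, hl₀⟩
  rw [show E = ⊥ from hbot, Submodule.mem_bot] at h0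
  simpa using congrFun h0 l₀

/-- If as many power moments as there are nodes vanish, then the weights of all nodes taking a common
value sum to zero. -/
theorem sum_filter_eq_zero_of_forall_sum_pow_mul_eq_zero {ι K : Type*} [Fintype ι] [Field K]
    [DecidableEq K] {v c : ι → K} (h : ∀ s < Fintype.card ι, ∑ l, v l ^ s * c l = 0) (μ : K) :
    ∑ l with v l = μ, c l = 0 := by
  by_cases hμ : μ ∈ univ.image v
  swap
  · rw [filter_eq_empty_iff.2 fun {l} _ (hl : v l = μ) =>
      hμ (hl ▸ mem_image_of_mem v (mem_univ l)), sum_empty]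
  -- `P` vanishes at all values of `v` except `μ`.
  let P : Polynomial K := ∏ ν ∈ (univ.image v).erase μ, (Polynomial.X - Polynomial.C ν)
  have hdeg : P.natDegree < Fintype.card ι := by
    rw [Polynomial.natDegree_finsetProd_X_sub_C_eq_card, card_erase_of_mem hμ]
    have h1 : 0 < #(univ.image v) := card_pos.2 ⟨μ, hμ⟩
    have h2 : #(univ.image v) ≤ Fintype.card ι := card_image_le
    omega
  have hP0 : P.eval μ ≠ 0 := by
    rw [Polynomial.eval_prod]
    refine prod_ne_zero_iff.2 fun ν hν => ?_
    simpa [sub_eq_zero] using (ne_of_mem_erase hν).symm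
  have hPv : ∀ l, v l ≠ μ → P.eval (v l) = 0 := fun l hl => by
    rw [Polynomial.eval_prod]
    exact prod_eq_zero (mem_erase.2 ⟨hl, mem_image_of_mem v (mem_univ l)⟩) (by simp)
  have hsum : ∑ l, P.eval (v l) * c l = 0 := by
    simp_rw [Polynomial.eval_eq_sum_range, sum_mul]
    rw [sum_comm]
    refine sum_eq_zero fun s hs => ?_
    simp_rw [mul_assoc]
    rw [← mul_sum, h s ((Nat.lt_succ_iff.1 (mem_range.1 hs)).trans_lt hdeg), mul_zero]
  have hsplit : ∑ l, P.eval (v l) * c l = P.eval μ * ∑ l with v l = μ, c l := by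
    rw [mul_sum, sum_filter]
    refine sum_congr rfl fun l _ => ?_
    split_ifs with hl
    · rw [hl]
    · rw [hPv l hl, zero_mul]
  exact (mul_eq_zero.1 (hsplit ▸ hsum)).resolve_left hP0

variable {d : ℕ} [NeZero d]

theorem dft_circConv (a f : ZMod d → ℂ) (n : ZMod d) :
    dft (circConv a f) n = dft a n * dft f n := by
  simp only [dft_apply, circConv, smul_eq_mul, mul_sum, sum_mul]
  rw [sum_comm]
  conv_rhs => rw [sum_comm]
  refine sum_congr rfl fun j _ => ?_
  rw [← Equiv.sum_comp (Equiv.addRight j)]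
  refine sum_congr rfl fun i _ => ?_
  rw [Equiv.coe_addRight, add_sub_cancel_right, add_mul, neg_add, AddChar.map_add_eq_mul]
  ring

theorem dft_pow_mulVec {a : ZMod d → ℂ} {A : Matrix (ZMod d) (ZMod d) ℂ}
    (hA : ∀ f : ZMod d → ℂ, A.mulVec f = circConv a f) (s : ℕ) (f : ZMod d → ℂ) (n : ZMod d) :
    dft ((A ^ s).mulVec f) n = dft a n ^ s * dft f n := by
  induction s with
  | zero => simp
  | succ s ih => rw [pow_succ', ← Matrix.mulVec_mulVec, hA, dft_circConv, ih, pow_succ', mul_assoc]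

/-- Parseval's identity, for the bilinear pairing. -/
theorem sum_mul_eq_inv_mul_sum_dft (u h : ZMod d → ℂ) :
    ∑ k, u k * h k = (d : ℂ)⁻¹ * ∑ n, dft u n * dft h (-n) := by
  have hu : ∀ k, u k = (d : ℂ)⁻¹ * ∑ n, stdAddChar (n * k) * dft u n := fun k => by
    conv_lhs => rw [← dft.symm_apply_apply u, invDFT_apply]
    rfl
  conv_lhs => enter [2, k]; rw [hu k, mul_assoc, sum_mul]
  rw [← mul_sum, sum_comm]
  congr 1
  refine sum_congr rfl fun n _ => ?_
  rw [dft_apply h, mul_sum]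
  refine sum_congr rfl fun k _ => ?_
  rw [smul_eq_mul, mul_neg, neg_neg, mul_comm k n]
  ring

/-- Orthogonality to `A ^ s e_i` (here `h` is a complex conjugate vector) read on the Fourier side. -/
theorem sum_stdAddChar_eq_zero {a h : ZMod d → ℂ} {A : Matrix (ZMod d) (ZMod d) ℂ}
    (hA : ∀ f : ZMod d → ℂ, A.mulVec f = circConv a f) {s : ℕ} {i : ZMod d}
    (hi : ∑ k, (A ^ s).mulVec (Pi.single i 1) k * h k = 0) :
    ∑ n, dft a n ^ s * stdAddChar (-(i * n)) * dft h (-n) = 0 := by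
  rw [sum_mul_eq_inv_mul_sum_dft] at hi
  have h0 := (mul_eq_zero.1 hi).resolve_left (inv_ne_zero (Nat.cast_ne_zero.2 (NeZero.ne d)))
  rw [← h0]
  refine sum_congr rfl fun n _ => ?_
  rw [dft_pow_mulVec hA, dft_apply (Pi.single i 1)]
  congr 2
  rw [sum_eq_single i (fun j _ hj => by simp [Pi.single_eq_of_ne hj]) (by simp)]
  simp

/-- Every frequency modulo `d = m * J` is uniquely of the form `k + l * J` with `k < J`, `l < m`. -/
theorem bijective_natCast_add_val_mul {m J : ℕ} [NeZero m] (hd : d = m * J) :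
    Function.Bijective fun q : Fin J × ZMod m => (((q.1 : ℕ) + q.2.val * J : ℕ) : ZMod d) := by
  have hlt : ∀ q : Fin J × ZMod m, (q.1 : ℕ) + q.2.val * J < d := by
    rintro ⟨k, l⟩
    have h1 := k.isLt
    have h2 : (l.val + 1) * J ≤ m * J := Nat.mul_le_mul_right J (ZMod.val_lt l)
    rw [hd]
    simp only
    linarith
  rw [Fintype.bijective_iff_injective_and_card]
  refine ⟨?_, by simp [ZMod.card, hd, mul_comm]⟩
  rintro ⟨k, l⟩ ⟨k', l'⟩ h
  have h1 := congrArg ZMod.val h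
  simp only [ZMod.val_cast_of_lt (hlt (k, l)), ZMod.val_cast_of_lt (hlt (k', l'))] at h1
  have hJ : 0 < J := k.pos
  have hk : (k : ℕ) = k' := by
    have := congrArg (· % J) h1
    simpa [Nat.mod_eq_of_lt] using this
  rw [hk, Nat.add_left_cancel_iff] at h1
  exact Prod.ext (Fin.ext hk) (ZMod.val_injective m (Nat.eq_of_mul_eq_mul_right hJ h1))

/-- The character of `ℤ/dℤ` at an index `m * t + r` and a frequency `k + l * J`, where `d = m * J`:
the cross term in `t` and `l` disappears, and `l * r` only matters modulo `m`. -/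
theorem stdAddChar_neg_mul_split {m J : ℕ} [NeZero m] (hd : d = m * J) (t k : ℕ) (r l : ZMod m) :
    (stdAddChar (-(((m * t + r.val : ℕ) : ZMod d) * ((k + l.val * J : ℕ) : ZMod d))) : ℂ)
      = stdAddChar (-((r.val * k : ℕ) : ZMod d)) * stdAddChar (-(l * r))
        * (stdAddChar (-((m * k : ℕ) : ZMod d))) ^ t := by
  have hmJ : (m : ZMod d) * (J : ZMod d) = 0 := by
    rw [← Nat.cast_mul, ← hd, ZMod.natCast_self]
  have hlr : (stdAddChar (-(l * r)) : ℂ)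
      = stdAddChar (-((r.val * (l.val * J) : ℕ) : ZMod d)) := by
    have h1 := stdAddChar_coe (N := m) (-((l.val * r.val : ℕ) : ℤ))
    have h2 := stdAddChar_coe (N := d) (-((r.val * (l.val * J) : ℕ) : ℤ))
    rw [Int.cast_neg, Int.cast_natCast] at h1 h2
    rw [h2, ← ZMod.natCast_zmod_val l, ← ZMod.natCast_zmod_val r, ← Nat.cast_mul,
      ZMod.natCast_zmod_val, ZMod.natCast_zmod_val, h1]
    have hm0 : (m : ℂ) ≠ 0 := Nat.cast_ne_zero.2 (NeZero.ne m)
    have hJ0 : (J : ℂ) ≠ 0 := Nat.cast_ne_zero.2 fun h => NeZero.ne d (by rw [hd, h, mul_zero])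
    congr 1
    rw [hd]
    push_cast
    field_simp
  rw [hlr, ← AddChar.map_nsmul_eq_pow, ← AddChar.map_add_eq_mul, ← AddChar.map_add_eq_mul]
  congr 1
  push_cast
  rw [nsmul_eq_mul]
  linear_combination (-(t : ZMod d) * (l.val : ZMod d)) * hmJ

end Analysis

/-! ### Iterates of a convolution operator -/

section Frame

open Finset ZMod

/-- Grouping frequencies modulo `J`, a vector orthogonal to the iterates splits into one system of
moment equations for each slice of the Fourier transform of `a`. -/
theorem sum_fourierSlice_pow_mul_eq_zero {d m J : ℕ} [NeZero d] [NeZero m] (hd : d = m * J)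
    {W : Finset (ZMod m)} {a h : ZMod d → ℂ} {A : Matrix (ZMod d) (ZMod d) ℂ}
    (hA : ∀ f : ZMod d → ℂ, A.mulVec f = circConv a f)
    (hh : ∀ i ∈ periodicUnion d m W, ∀ s < m, ∑ k, (A ^ s).mulVec (Pi.single i 1) k * h k = 0)
    {r : ZMod m} (hr : r ∈ W) {s : ℕ} (hs : s < m) (k : Fin J) :
    ∑ l : ZMod m, fourierSlice m J a k l ^ s
      * (stdAddChar (-(l * r)) * dft h (-(((k : ℕ) + l.val * J : ℕ) : ZMod d))) = 0 := by
  let θ : Fin J → ℂ := fun k => stdAddChar (-((m * k : ℕ) : ZMod d))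
  have hθ : Function.Injective θ := by
    intro k k' hkk'
    have h1 := neg_injective (injective_stdAddChar hkk')
    have hlt : ∀ k : Fin J, m * (k : ℕ) < d := fun k => by
      rw [hd]
      exact Nat.mul_lt_mul_of_pos_left k.isLt (NeZero.pos m)
    have h2 := congrArg ZMod.val h1
    rw [ZMod.val_cast_of_lt (hlt k), ZMod.val_cast_of_lt (hlt k')] at h2
    exact Fin.ext (Nat.eq_of_mul_eq_mul_left (NeZero.pos m) h2)
  -- The index `m * t + r ∈ Ω` yields the `t`-th moment of `u` at the nodes `θ k`.
  let u : Fin J → ℂ := fun k => stdAddChar (-((r.val * k : ℕ) : ZMod d)) *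
    ∑ l : ZMod m, fourierSlice m J a k l ^ s
      * (stdAddChar (-(l * r)) * dft h (-(((k : ℕ) + l.val * J : ℕ) : ZMod d)))
  have hu : u = 0 := by
    refine Matrix.eq_zero_of_forall_pow_sum_mul_pow_eq_zero hθ fun t => ?_
    have hmem : ((m * (t : ℕ) + r.val : ℕ) : ZMod d) ∈ periodicUnion d m W := by
      simp only [periodicUnion, mem_filter, mem_univ, true_and]
      exact ⟨r, hr, ((m * (t : ℕ) : ℕ) : ZMod d), ⟨(t : ℕ), by simp [mul_comm]⟩, by push_cast; rfl⟩
    have h0 := sum_stdAddChar_eq_zero hA (hh _ hmem s hs)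
    rw [← (bijective_natCast_add_val_mul hd).sum_comp, Fintype.sum_prod_type] at h0
    rw [← h0]
    refine sum_congr rfl fun k _ => ?_
    simp only [u, mul_sum, sum_mul]
    refine sum_congr rfl fun l _ => ?_
    rw [stdAddChar_neg_mul_split hd]
    simp only [fourierSlice, θ]
    ring
  have huk := congrFun hu k
  refine (mul_eq_zero.1 huk).resolve_left ?_
  rw [stdAddChar_apply]
  exact Circle.coe_ne_zero _

/-- Each column set to which the full spark property is applied is the set of frequencies in one
slice sharing an eigenvalue; it has at most `L` elements since it bounds a geometric multiplicity
from below. -/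
theorem eq_zero_of_forall_sum_mul_eq_zero {d m J : ℕ} [NeZero d] [NeZero m] (hd : d = m * J)
    {W : Finset (ZMod m)} (hW : HasFullSpark W) {A : Matrix (ZMod d) (ZMod d) ℂ}
    (hA : A ∈ classB d m J #W) {h : ZMod d → ℂ}
    (hh : ∀ i ∈ periodicUnion d m W, ∀ s < m, ∑ k, (A ^ s).mulVec (Pi.single i 1) k * h k = 0) :
    h = 0 := by
  obtain ⟨a, ha, hsup⟩ := hA
  suffices hdft : dft h = 0 by simpa using hdft
  funext n
  obtain ⟨⟨k, l⟩, hn⟩ := (bijective_natCast_add_val_mul hd).surjective (-n)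
  have hcard : #{x | fourierSlice m J a k x = fourierSlice m J a k l} ≤ #W :=
    (card_filter_le_maxGeomMult_diagonal _ _).trans
      (hsup ▸ le_sup (f := fun k => maxGeomMult (Matrix.diagonal (fourierSlice m J a k)))
        (mem_range.2 k.isLt))
  have h0 := hW _ hcard (fun x => dft h (-(((k : ℕ) + x.val * J : ℕ) : ZMod d)))
    (fun r hr => sum_filter_eq_zero_of_forall_sum_pow_mul_eq_zero
      (fun s hs => sum_fourierSlice_pow_mul_eq_zero hd ha hh hr (by simpa [ZMod.card] using hs) k) _)
    l (by simp)
  simp only at h0 hn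
  rw [hn, neg_neg] at h0
  exact h0

theorem isFiniteFrame_iterates {d m J : ℕ} [NeZero d] [NeZero m] (hd : d = m * J)
    {W : Finset (ZMod m)} (hW : HasFullSpark W) {A : Matrix (ZMod d) (ZMod d) ℂ}
    (hA : A ∈ classB d m J #W) : IsFiniteFrame (iterates m A (periodicUnion d m W)) := by
  refine isFiniteFrame_of_forall_inner_eq_zero fun f hf => ?_
  have h0 : (fun k => star (f k)) = 0 := by
    refine eq_zero_of_forall_sum_mul_eq_zero hd hW hA fun i hi s hs => ?_
    have h1 := congrArg star (hf (⟨i, hi⟩, ⟨s, hs⟩))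
    rw [iterates, PiLp.inner_apply, star_zero, star_sum] at h1
    rw [← h1]
    refine sum_congr rfl fun k _ => ?_
    simp [mul_comm]
  ext k
  simpa using congrFun h0 k

end Frame

theorem mainTheorem11 (d m J L : ℕ) [NeZero d] [NeZero m] (hd : d = m * J) (hm : 1 < m)
    (W : Finset (ZMod m)) (hW : W.card = L) (hL : L < m) :
    (W = (Finset.range L).image (fun n : ℕ => (n : ZMod m)) →
      ∀ A ∈ classB d m J L, IsFiniteFrame (iterates m A (periodicUnion d m W))) ∧
    (Nat.Prime m →
      ∀ A ∈ classB d m J L, IsFiniteFrame (iterates m A (periodicUnion d m W))) ∧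
    (IsPrimePow m → UniformlyDistributedOverDivisors m W →
      ∀ A ∈ classB d m J L, IsFiniteFrame (iterates m A (periodicUnion d m W))) := by
  subst hW
  refine ⟨fun h A hA => ?_, fun h A hA => ?_, fun h hdist A hA => ?_⟩
  · exact isFiniteFrame_iterates hd (h ▸ hasFullSpark_image_range hL) hA
  · exact isFiniteFrame_iterates hd (hasFullSpark_of_prime h W) hA
  · exact isFiniteFrame_iterates hd (hasFullSpark_of_uniformlyDistributed h hdist) hA
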